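/- **Setting.** Consider a memoryless binary-input channel (not necessarily symmetric) with output laws $W_0,W_1$ on a measurable space. For $x\in\{0,1\}$ let $P^{(0)}(x)$ be the law, under $W_x$, of the log-likelihood ratio $\ln\frac{\mathsf P(y|X=x)}{\mathsf P(y|X=\bar x)}\in[-\infty,\infty]$. For a function $f$ on $\{0,1\}$ write $\langle f\rangle=\frac{f(0)+f(1)}2$. Let $\lambda(z)=\sum_k\lambda_kz^{k-1}$ and $\rho(z)=\sum_k\rho_kz^{k-1}$ be edge degree distributions, i.e. polynomials with nonnegative coefficients and $\lambda(1)=\rho(1)=1$. Let $\gamma(m)=(1_{\{m\le 0\}},\ln\coth|m/2|)\in \mathrm{GF}(2)\times[0,\infty]$, with inverse $\gamma^{-1}(k,r)=(-1)^k\ln\coth(r/2)$, and let $\Gamma$, $\Gamma^{-1}$ denote the images of finite signed measures under $\gamma$, $\gamma^{-1}$. Write $\otimes$ for convolution of finite signed measures; a polynomial is evaluated at a signed measure with all products replaced by convolutions. For check polynomial $\rho$, the generalized density evolution of linear LDPC codes is, for $l\ge1$, $$P^{(l)}(x)=P^{(0)}(x)\otimes\lambda\big(Q^{(l-1)}(x)\big),$$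 $$Q^{(l-1)}(x)=\Gamma^{-1}\Big(\rho\big(\Gamma(\tfrac{P^{(l-1)}(0)+P^{(l-1)}(1)}2)\big)+(-1)^x\rho\big(\Gamma(\tfrac{P^{(l-1)}(0)-P^{(l-1)}(1)}2)\big)\Big),$$ and the density evolution of the coset code ensemble is $P^{(0)}_{coset}=\langle P^{(0)}\rangle$ and, for $l\ge1$, $$P^{(l)}_{coset}=\langle P^{(0)}\rangle\otimes\lambda\big(Q^{(l-1)}_{coset}\big),\qquad Q^{(l-1)}_{coset}=\Gamma^{-1}\big(\rho(\Gamma(P^{(l-1)}_{coset}))\big).$$ **Theorem.** Fix the channel and $\lambda,\rho$. For $\Delta\ge1$ let $\langle P^{(l)}\rangle$ and $P^{(l)}_{coset}$ be the densities obtained from these recursions with $\rho$ replaced by $\rho_\Delta(z)=z^\Delta\rho(z)$. They are probability distributions on $[-\infty,\infty]$. Moreover, for every $l_0\in\mathbb N$: 1. for every $l\le l_0$, $\langle P^{(l)}\rangle$ and $P^{(l)}_{coset}$ converge in distribution, as $\Delta\to\infty$, to the same limit; 2. the rate is $\mathcal O(\mathrm{const}^\Delta)$: there are constants $C$ and $0<c<1$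 such that $$\Big|\int f\,d\langle P^{(l)}\rangle-\int f\,dP^{(l)}_{coset}\Big|\le C\,c^\Delta$$ for all $\Delta\ge1$, all $l\le l_0$ and all $f:[-\infty,\infty]\to[-1,1]$ that are $1$-Lipschitz on $\mathbb R$ (i.e. in the bounded Lipschitz distance). -/

import Mathlib

open MeasureTheory Filter Topology Polynomial
open scoped ENNReal

noncomputable section

namespace LDPC

/-! ### Convolution algebra of finite signed measures -/

/-- Convolution `μ ⊗ ν` of signed measures on an additive monoid: the image of the product
measure under addition. -/
def sconv {G : Type*} [AddMonoid G] [MeasurableSpace G] (μ ν : SignedMeasure G) :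
    SignedMeasure G :=
  (VectorMeasure.prod μ ν (ContinuousLinearMap.mul ℝ ℝ)).map (fun p : G × G => p.1 + p.2)

/-- Convolution powers; the zeroth power is the unit mass at `0`. -/
def convPow {G : Type*} [AddMonoid G] [MeasurableSpace G] (μ : SignedMeasure G) :
    ℕ → SignedMeasure G
  | 0 => (Measure.dirac (0 : G)).toSignedMeasure
  | n + 1 => sconv (convPow μ n) μ

/-- The value `p(μ) = ∑ⱼ pⱼ μ^{⊗ j}` of a real polynomial at a signed measure, with all products
replaced by convolutions. -/
def polyConv {G : Type*} [AddMonoid G] [MeasurableSpace G] (p : ℝ[X]) (μ : SignedMeasure G) :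
    SignedMeasure G :=
  p.sum fun j c => c • convPow μ j

/-! ### Log-likelihood messages and the transform `γ`

Messages take values in `[-∞, ∞]` (the value `+∞` occurs, e.g. for Z-channels), and the second
coordinate of `γ` in `[0, ∞]`. -/

/-- `r ↦ ln coth (r / 2)` on `[0, ∞]`, with `0 ↦ ∞` and `∞ ↦ 0`. It is an involution. -/
def lnCoth (r : ℝ≥0∞) : ℝ≥0∞ :=
  if r = 0 then ⊤
  else if r = ⊤ then 0
  else ENNReal.ofReal (Real.log (Real.cosh (r.toReal / 2) / Real.sinh (r.toReal / 2)))

/-- `γ(m) = (1_{m ≤ 0}, ln coth |m / 2|) ∈ GF(2) × [0, ∞]`. -/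
def gam (m : EReal) : ZMod 2 × ℝ≥0∞ :=
  (if m ≤ 0 then 1 else 0, lnCoth m.abs)

/-- The inverse `γ⁻¹(k, r) = (-1)^k ln coth (r / 2)` of `γ`. -/
def gamInv (p : ZMod 2 × ℝ≥0∞) : EReal :=
  if p.1 = 0 then (lnCoth p.2 : EReal) else -(lnCoth p.2 : EReal)

/-- The operator `Γ`: image of a (signed) distribution under `γ`. -/
def Gam (μ : SignedMeasure EReal) : SignedMeasure (ZMod 2 × ℝ≥0∞) := μ.map gam

/-- The operator `Γ⁻¹`: image of a (signed) distribution under `γ⁻¹`. -/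
def GamInv (μ : SignedMeasure (ZMod 2 × ℝ≥0∞)) : SignedMeasure EReal := μ.map gamInv

/-! ### Channels, degree distributions, density evolutions -/

/-- Edge degree distribution `∑ₖ pₖ z^(k-1)`: `pₖ` is the fraction of edges that are connected to
nodes of degree `k`. -/
def IsDegreeDistribution (p : ℝ[X]) : Prop :=
  (∀ j, 0 ≤ p.coeff j) ∧ p.eval 1 = 1

variable {Y : Type*} [MeasurableSpace Y]

/-- For the memoryless binary-input channel with output law `W x` given input `x`, the
log-likelihood ratio `ln (P(y | X = x) / P(y | X = x̄))` of the output `y`. Densities are taken with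
respect to `W 0 + W 1`. -/
def channelLLR (W : ZMod 2 → ProbabilityMeasure Y) (x : ZMod 2) (y : Y) : EReal :=
  ENNReal.log
    ((W x : Measure Y).rnDeriv ((W 0 : Measure Y) + (W 1 : Measure Y)) y /
      (W (x + 1) : Measure Y).rnDeriv ((W 0 : Measure Y) + (W 1 : Measure Y)) y)

/-- `P⁽⁰⁾(x)`: the law of the log-likelihood ratio given that `x` was transmitted. -/
def initialDensity (W : ZMod 2 → ProbabilityMeasure Y) (x : ZMod 2) : SignedMeasure EReal :=
  ((W x : Measure Y).map (channelLLR W x)).toSignedMeasure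

/-- The average `⟨f⟩ = (f 0 + f 1) / 2`. -/
def avg (f : ZMod 2 → SignedMeasure EReal) : SignedMeasure EReal :=
  (1 / 2 : ℝ) • (f 0 + f 1)

/-- Check node step of the generalized density evolution for linear codes:
`Q(x) = Γ⁻¹(ρ(Γ((P(0) + P(1)) / 2)) + (-1)^x ρ(Γ((P(0) - P(1)) / 2)))`. -/
def linearCheck (rho : ℝ[X]) (P : ZMod 2 → SignedMeasure EReal) (x : ZMod 2) :
    SignedMeasure EReal :=
  GamInv (polyConv rho (Gam ((1 / 2 : ℝ) • (P 0 + P 1))) +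
    (-1 : ℝ) ^ x.val • polyConv rho (Gam ((1 / 2 : ℝ) • (P 0 - P 1))))

/-- Generalized density evolution for linear codes: `P⁽ˡ⁾(x) = P⁽⁰⁾(x) ⊗ λ(Q⁽ˡ⁻¹⁾(x))`. -/
def linearDensity (W : ZMod 2 → ProbabilityMeasure Y) (lam rho : ℝ[X]) :
    ℕ → ZMod 2 → SignedMeasure EReal
  | 0, x => initialDensity W x
  | l + 1, x =>
      sconv (initialDensity W x) (polyConv lam (linearCheck rho (linearDensity W lam rho l) x))

/-- Density evolution of the coset code ensemble: `P⁽ˡ⁾ = ⟨P⁽⁰⁾⟩ ⊗ λ(Q⁽ˡ⁻¹⁾)` with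
`Q⁽ˡ⁻¹⁾ = Γ⁻¹(ρ(Γ(P⁽ˡ⁻¹⁾)))`. -/
def cosetDensity (W : ZMod 2 → ProbabilityMeasure Y) (lam rho : ℝ[X]) :
    ℕ → SignedMeasure EReal
  | 0 => avg (initialDensity W)
  | l + 1 =>
      sconv (avg (initialDensity W))
        (polyConv lam (GamInv (polyConv rho (Gam (cosetDensity W lam rho l)))))

/-! ### Quantitative convergence in distribution -/

/-- Test functions of the bounded Lipschitz distance: bounded by `1` and `1`-Lipschitz on `ℝ`. The
values at `±∞` are only required to be bounded by `1`, so the masses at `±∞` are compared too. -/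
def IsBLTest (f : EReal → ℝ) : Prop :=
  (∀ m, |f m| ≤ 1) ∧ ∀ a b : ℝ, |f (a : EReal) - f (b : EReal)| ≤ |a - b|

end LDPC

end

/-! Both evolutions converge to the initial average `⟨P⁽⁰⁾⟩`: large check degrees make the check
messages so weak that neither density moves far from its start. Strength is measured by the mean `t`
of `|tanh (m / 2)|`. It is subadditive when messages are added at a variable node
(`absTanh_add_le`). At a check node it is multiplicative, because `γ` turns `|tanh (m / 2)|` into
`exp (-r)` and adds the `r`.

Each check message combines at least `Δ` others, so averaged over the input its strength is at most
`t ^ Δ` (`lintegral_absTanh_checkMeas_add_le`). With `L = meanExponent lam` this gives `t (l + 1) ≤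
t 0 + L * t l ^ Δ` (`meanTanh_evolve_succ_le`). If `t 0 < 1`, choose `θ` with `t 0 < θ < 1`: for
large `Δ` the interval `[0, θ]` is invariant, and `P⁽ˡ⁾` is `P⁽⁰⁾` perturbed by independent messages
of mean strength at most `L * θ ^ Δ`, uniformly in `l`. If `t 0 = 1`, all messages are infinite; a
log-likelihood ratio under the true input is never `-∞`, so both initial laws are the unit mass at
`+∞`, which the evolution fixes.

These estimates need positive measures. The half sum and half difference in the check step form the
Fourier transform over `GF(2)` of the pair `P(0)`, `P(1)`; inverting it after taking powers gives
the laws `parityPow` of sums conditioned on parity. The coset evolution is the same recursion with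
`⟨P⁽⁰⁾⟩` for both inputs, so one estimate covers both. -/

noncomputable section

namespace LDPC

/-! ### Comparison of signed and positive measures -/

section Mixture

variable {X : Type*} [MeasurableSpace X]

/-- The mixture `∑ⱼ pⱼ mⱼ` of the measures `mⱼ` with the coefficients of `p` as weights. -/
def mixture (p : ℝ[X]) (m : ℕ → Measure X) : Measure X :=
  ∑ j ∈ p.support, ENNReal.ofReal (p.coeff j) • m j

instance (p : ℝ[X]) (m : ℕ → Measure X) [∀ j, IsFiniteMeasure (m j)] :
    IsFiniteMeasure (mixture p m) := by
  unfold mixture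
  have (j : ℕ) : IsFiniteMeasure (ENNReal.ofReal (p.coeff j) • m j) :=
    Measure.smul_finite _ ENNReal.ofReal_ne_top
  infer_instance

theorem IsDegreeDistribution.sum_eq_one {p : ℝ[X]} (hp : IsDegreeDistribution p) :
    ∑ j ∈ p.support, ENNReal.ofReal (p.coeff j) = 1 := by
  rw [← ENNReal.ofReal_sum_of_nonneg fun j _ => hp.1 j, ← ENNReal.ofReal_one, ← hp.2,
    Polynomial.eval_eq_sum, Polynomial.sum]
  simp

theorem isProbabilityMeasure_mixture {p : ℝ[X]} (hp : IsDegreeDistribution p)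
    {m : ℕ → Measure X} (hm : ∀ j ∈ p.support, IsProbabilityMeasure (m j)) :
    IsProbabilityMeasure (mixture p m) := by
  constructor
  rw [mixture, Measure.finsetSum_apply]
  rw [← hp.sum_eq_one]
  refine Finset.sum_congr rfl fun j hj => ?_
  have := hm j hj
  simp

theorem mixture_toSignedMeasure {p : ℝ[X]} (hp : ∀ j, 0 ≤ p.coeff j) (m : ℕ → Measure X)
    [∀ j, IsFiniteMeasure (m j)] :
    (mixture p m).toSignedMeasure = p.sum fun j c => c • (m j).toSignedMeasure := by
  ext s hs
  rw [Measure.toSignedMeasure_apply_measurable hs, Polynomial.sum, FunLike.coe_sum,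
    Finset.sum_apply, mixture, Measure.real, Measure.finsetSum_apply, ENNReal.toReal_sum]
  · refine Finset.sum_congr rfl fun j _ => ?_
    simp [Measure.toSignedMeasure_apply_measurable hs, hp j, Measure.real]
  · intro j _
    simp [ENNReal.mul_eq_top]

theorem map_toSignedMeasure {Z : Type*} [MeasurableSpace Z] {f : X → Z}
    (hf : Measurable f) (μ : Measure X) [IsFiniteMeasure μ] [IsFiniteMeasure (μ.map f)] :
    μ.toSignedMeasure.map f = (μ.map f).toSignedMeasure := by
  ext s hs
  rw [VectorMeasure.map_apply _ hf hs, Measure.toSignedMeasure_apply_measurable (hf hs),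
    Measure.toSignedMeasure_apply_measurable hs, map_measureReal_apply hf hs]

end Mixture

/-! ### Convolution powers and sums conditioned on parity. -/

section Convolution

variable {G : Type*} [AddMonoid G] [MeasurableSpace G]

/-- A product of vector measures is determined by its values on rectangles, where bilinearity is
plain algebra. Two terms per factor suffice for half sums and half differences. -/
theorem sconv_linear_combination [MeasurableAdd₂ G] (μ₁ μ₂ ν₁ ν₂ : Measure G) [IsFiniteMeasure μ₁]
    [IsFiniteMeasure μ₂] [IsFiniteMeasure ν₁] [IsFiniteMeasure ν₂] (a b c d : ℝ) :
    sconv (a • μ₁.toSignedMeasure + b • μ₂.toSignedMeasure)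
        (c • ν₁.toSignedMeasure + d • ν₂.toSignedMeasure) =
      (a * c) • (μ₁.conv ν₁).toSignedMeasure + (a * d) • (μ₁.conv ν₂).toSignedMeasure +
        (b * c) • (μ₂.conv ν₁).toSignedMeasure + (b * d) • (μ₂.conv ν₂).toSignedMeasure := by
  have key : VectorMeasure.prod (a • μ₁.toSignedMeasure + b • μ₂.toSignedMeasure)
      (c • ν₁.toSignedMeasure + d • ν₂.toSignedMeasure) (ContinuousLinearMap.mul ℝ ℝ) =
      (a * c) • (μ₁.prod ν₁).toSignedMeasure + (a * d) • (μ₁.prod ν₂).toSignedMeasure +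
        (b * c) • (μ₂.prod ν₁).toSignedMeasure + (b * d) • (μ₂.prod ν₂).toSignedMeasure := by
    refine VectorMeasure.prod_eq_of_forall_apply_prod fun s t hs ht => ?_
    simp only [add_apply, smul_apply,
      Measure.toSignedMeasure_apply_measurable (hs.prod ht),
      Measure.toSignedMeasure_apply_measurable hs, Measure.toSignedMeasure_apply_measurable ht,
      measureReal_prod_prod, ContinuousLinearMap.mul_apply', smul_eq_mul]
    ring
  have hm : Measurable fun p : G × G => p.1 + p.2 := measurable_add
  rw [sconv, key]
  simp only [VectorMeasure.map_add, VectorMeasure.map_smul]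
  rw [map_toSignedMeasure hm, map_toSignedMeasure hm, map_toSignedMeasure hm,
    map_toSignedMeasure hm]
  rfl

theorem sconv_toSignedMeasure [MeasurableAdd₂ G] (μ ν : Measure G) [IsFiniteMeasure μ]
    [IsFiniteMeasure ν] :
    sconv μ.toSignedMeasure ν.toSignedMeasure = (μ.conv ν).toSignedMeasure := by
  simpa using sconv_linear_combination μ 0 ν 0 1 0 1 0

/-- Convolution powers of a positive measure. -/
def measPow (μ : Measure G) : ℕ → Measure G
  | 0 => Measure.dirac 0
  | n + 1 => (measPow μ n).conv μ

instance (μ : Measure G) [IsProbabilityMeasure μ] [MeasurableAdd₂ G] (n : ℕ) :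
    IsProbabilityMeasure (measPow μ n) := by
  induction n with
  | zero => unfold measPow; infer_instance
  | succ n ih => unfold measPow; infer_instance

theorem convPow_toSignedMeasure [MeasurableAdd₂ G] (μ : Measure G) [IsProbabilityMeasure μ] (n : ℕ) :
    convPow μ.toSignedMeasure n = (measPow μ n).toSignedMeasure := by
  induction n with
  | zero => rfl
  | succ n ih => rw [convPow, ih, sconv_toSignedMeasure]; rfl

theorem polyConv_toSignedMeasure [MeasurableAdd₂ G] {p : ℝ[X]} (hp : ∀ j, 0 ≤ p.coeff j)
    (μ : Measure G) [IsProbabilityMeasure μ] :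
    polyConv p μ.toSignedMeasure = (mixture p (measPow μ)).toSignedMeasure := by
  rw [mixture_toSignedMeasure hp, polyConv]
  simp only [convPow_toSignedMeasure]

/-- The conditional laws of a sum of `n` independent terms of types `x₁, …, xₙ` (of law `U xᵢ`),
given that the uniformly chosen types have sum `x`. For `n = 0` these are twice the unit mass
and zero. -/
def parityPow (U : ZMod 2 → Measure G) : ℕ → ZMod 2 → Measure G
  | 0, x => if x = 0 then (2 : ℝ≥0∞) • Measure.dirac 0 else 0
  | n + 1, x => (2⁻¹ : ℝ≥0∞) • ((parityPow U n 0).conv (U x) + (parityPow U n 1).conv (U (x + 1)))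

instance (U : ZMod 2 → Measure G) [∀ x, IsProbabilityMeasure (U x)] [MeasurableAdd₂ G] (n : ℕ)
    (x : ZMod 2) : IsFiniteMeasure (parityPow U n x) := by
  induction n generalizing x with
  | zero =>
    unfold parityPow
    split_ifs
    · exact Measure.smul_finite _ (by simp)
    · infer_instance
  | succ n ih =>
    unfold parityPow
    exact Measure.smul_finite _ (by simp)

end Convolution

section ParityPow

variable {G : Type*} [AddMonoid G] [MeasurableSpace G] [MeasurableAdd₂ G]
  (U : ZMod 2 → Measure G) [∀ x, IsProbabilityMeasure (U x)]

theorem toSignedMeasure_half_smul_add {X : Type*} [MeasurableSpace X] (μ ν : Measure X)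
    [IsFiniteMeasure μ] [IsFiniteMeasure ν] [IsFiniteMeasure ((2⁻¹ : ℝ≥0∞) • (μ + ν))] :
    ((2⁻¹ : ℝ≥0∞) • (μ + ν)).toSignedMeasure =
      (1 / 2 : ℝ) • (μ.toSignedMeasure + ν.toSignedMeasure) := by
  ext s hs
  rw [Measure.toSignedMeasure_apply_measurable hs, measureReal_ennreal_smul_apply,
    measureReal_add_apply]
  simp [Measure.toSignedMeasure_apply_measurable hs, mul_add]

theorem parityPow_succ_toSignedMeasure (n : ℕ) (x : ZMod 2) :
    (parityPow U (n + 1) x).toSignedMeasure =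
      (1 / 2 : ℝ) • (((parityPow U n 0).conv (U x)).toSignedMeasure +
        ((parityPow U n 1).conv (U (x + 1))).toSignedMeasure) := by
  have : IsFiniteMeasure ((2⁻¹ : ℝ≥0∞) •
      ((parityPow U n 0).conv (U x) + (parityPow U n 1).conv (U (x + 1)))) :=
    Measure.smul_finite _ (by simp)
  exact toSignedMeasure_half_smul_add _ _

/-- Half sum and half difference are the two Fourier coefficients over `GF(2)`, and the recursion of
`parityPow` is convolution in the type variable, so each coefficient is simply raised to a power.
The start `2δ₀`, `0` makes both coefficients `δ₀`, the empty product. -/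
theorem convPow_half_add (n : ℕ) :
    convPow ((1 / 2 : ℝ) • ((U 0).toSignedMeasure + (U 1).toSignedMeasure)) n =
      (1 / 2 : ℝ) • ((parityPow U n 0).toSignedMeasure + (parityPow U n 1).toSignedMeasure) := by
  induction n with
  | zero =>
    ext s hs
    simp [convPow, parityPow, Measure.toSignedMeasure_apply_measurable hs,
      measureReal_ennreal_smul_apply]
  | succ n ih =>
    rw [convPow, ih, smul_add, smul_add, sconv_linear_combination,
      parityPow_succ_toSignedMeasure, parityPow_succ_toSignedMeasure,
      show (0 : ZMod 2) + 1 = 1 from rfl, show (1 : ZMod 2) + 1 = 0 from rfl]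
    module

theorem convPow_half_sub (n : ℕ) :
    convPow ((1 / 2 : ℝ) • ((U 0).toSignedMeasure - (U 1).toSignedMeasure)) n =
      (1 / 2 : ℝ) • ((parityPow U n 0).toSignedMeasure - (parityPow U n 1).toSignedMeasure) := by
  induction n with
  | zero =>
    ext s hs
    simp [convPow, parityPow, Measure.toSignedMeasure_apply_measurable hs,
      measureReal_ennreal_smul_apply]
  | succ n ih =>
    have (μ ν : SignedMeasure G) :
        (1 / 2 : ℝ) • (μ - ν) = (1 / 2 : ℝ) • μ + (-1 / 2 : ℝ) • ν := by module
    rw [convPow, ih, this, this, sconv_linear_combination,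
      parityPow_succ_toSignedMeasure, parityPow_succ_toSignedMeasure,
      show (0 : ZMod 2) + 1 = 1 from rfl, show (1 : ZMod 2) + 1 = 0 from rfl]
    module

/-- Fourier inversion over `GF(2)`, degree by degree: the negative parts cancel and a positive
measure remains. -/
theorem polyConv_half_add_half_sub {p : ℝ[X]} (hp : ∀ j, 0 ≤ p.coeff j) (x : ZMod 2) :
    polyConv p ((1 / 2 : ℝ) • ((U 0).toSignedMeasure + (U 1).toSignedMeasure)) +
        (-1 : ℝ) ^ x.val •
          polyConv p ((1 / 2 : ℝ) • ((U 0).toSignedMeasure - (U 1).toSignedMeasure)) =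
      (mixture p fun j => parityPow U j x).toSignedMeasure := by
  rw [mixture_toSignedMeasure hp, polyConv, polyConv, Polynomial.sum, Polynomial.sum,
    Polynomial.sum, Finset.smul_sum, ← Finset.sum_add_distrib]
  refine Finset.sum_congr rfl fun j _ => ?_
  rw [convPow_half_add, convPow_half_sub]
  fin_cases x
  · change _ + (-1 : ℝ) ^ 0 • _ = p.coeff j • (parityPow U j 0).toSignedMeasure
    module
  · change _ + (-1 : ℝ) ^ 1 • _ = p.coeff j • (parityPow U j 1).toSignedMeasure
    module

omit [∀ x, IsProbabilityMeasure (U x)] in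
theorem conv_univ_of_isProbabilityMeasure (μ ν : Measure G) [IsFiniteMeasure μ]
    [IsProbabilityMeasure ν] : (μ.conv ν) Set.univ = μ Set.univ := by
  rw [Measure.conv, Measure.map_apply measurable_add MeasurableSet.univ]
  simp [← Set.univ_prod_univ]

theorem parityPow_univ_add (n : ℕ) :
    parityPow U n 0 Set.univ + parityPow U n 1 Set.univ = 2 := by
  induction n with
  | zero => simp [parityPow]
  | succ n ih =>
    simp only [parityPow, Measure.smul_apply, Measure.add_apply, conv_univ_of_isProbabilityMeasure, ih, smul_eq_mul]
    rw [ENNReal.inv_mul_cancel (by simp) (by simp), one_add_one_eq_two]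

/-- The two masses sum to 2 for every `n`, and one further step averages them. At `n = 0` they are 2
and 0, so check polynomials must have no constant term. -/
theorem isProbabilityMeasure_parityPow {n : ℕ} (hn : n ≠ 0) (x : ZMod 2) :
    IsProbabilityMeasure (parityPow U n x) := by
  obtain ⟨n, rfl⟩ := Nat.exists_eq_succ_of_ne_zero hn
  constructor
  simp only [parityPow, Measure.smul_apply, Measure.add_apply, conv_univ_of_isProbabilityMeasure, smul_eq_mul,
    parityPow_univ_add]
  exact ENNReal.inv_mul_cancel (by simp) (by simp)

omit [∀ x, IsProbabilityMeasure (U x)] in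
-- If the law of a term does not depend on its type, conditioning on the parity has no effect. This
-- identifies the coset check step with the linear one.
theorem parityPow_const (μ : Measure G) [IsProbabilityMeasure μ] (n : ℕ) (x : ZMod 2) :
    parityPow (fun _ => μ) (n + 1) x = measPow μ (n + 1) := by
  have half (ν : Measure G) : (2⁻¹ : ℝ≥0∞) • (ν + ν) = ν := by
    rw [← two_smul ℝ≥0∞ ν, smul_smul, ENNReal.inv_mul_cancel (by simp) (by simp), one_smul]
  induction n generalizing x with
  | zero =>
    simp [parityPow, measPow, Measure.conv_smul_left, smul_smul,
      ENNReal.inv_mul_cancel]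
  | succ n ih => rw [parityPow, ih, ih, half]; rfl

end ParityPow

/-! ### Density evolution as a recursion on probability measures. -/

theorem measurable_lnCoth : Measurable lnCoth := by
  unfold lnCoth
  refine Measurable.ite (measurableSet_singleton _) measurable_const
    (Measurable.ite (measurableSet_singleton _) measurable_const ?_)
  fun_prop

theorem measurable_ereal_abs : Measurable EReal.abs := by
  refine EReal.measurable_of_measurable_real ?_
  simp only [EReal.abs_def]
  fun_prop

theorem measurable_gam : Measurable gam :=
  (Measurable.ite measurableSet_Iic measurable_const measurable_const).prodMk
    (measurable_lnCoth.comp measurable_ereal_abs)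

theorem measurable_gamInv : Measurable gamInv := by
  have h : Measurable fun p : ZMod 2 × ℝ≥0∞ => (lnCoth p.2 : EReal) :=
    (measurable_lnCoth.comp measurable_snd).coe_ereal_ennreal
  exact Measurable.ite (measurable_fst (measurableSet_singleton 0)) h h.neg

instance (μ : Measure EReal) [IsProbabilityMeasure μ] : IsProbabilityMeasure (μ.map gam) :=
  Measure.isProbabilityMeasure_map measurable_gam.aemeasurable

/-- The check node step on positive measures. -/
def checkMeas (rho : ℝ[X]) (μ : ZMod 2 → Measure EReal) (x : ZMod 2) : Measure EReal :=
  (mixture rho fun j => parityPow (fun y => (μ y).map gam) j x).map gamInv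

/-- Density evolution on positive measures, with initial laws `μ 0` and `μ 1`. -/
def evolve (lam rho : ℝ[X]) (μ : ZMod 2 → Measure EReal) : ℕ → ZMod 2 → Measure EReal
  | 0, x => μ x
  | l + 1, x => (μ x).conv (mixture lam (measPow (checkMeas rho (evolve lam rho μ l) x)))

theorem isProbabilityMeasure_checkMeas {rho : ℝ[X]} (hrho : IsDegreeDistribution rho)
    (h0 : rho.coeff 0 = 0) (μ : ZMod 2 → Measure EReal) [∀ x, IsProbabilityMeasure (μ x)]
    (x : ZMod 2) : IsProbabilityMeasure (checkMeas rho μ x) := by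
  have := isProbabilityMeasure_mixture hrho
    (m := fun j => parityPow (fun y => (μ y).map gam) j x) fun j hj =>
      isProbabilityMeasure_parityPow _ (by rintro rfl; simp [h0] at hj) x
  exact Measure.isProbabilityMeasure_map measurable_gamInv.aemeasurable

theorem isProbabilityMeasure_evolve {lam rho : ℝ[X]} (hlam : IsDegreeDistribution lam)
    (hrho : IsDegreeDistribution rho) (h0 : rho.coeff 0 = 0)
    (μ : ZMod 2 → Measure EReal) [∀ x, IsProbabilityMeasure (μ x)] (l : ℕ) (x : ZMod 2) :
    IsProbabilityMeasure (evolve lam rho μ l x) := by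
  induction l generalizing x with
  | zero => exact inferInstanceAs (IsProbabilityMeasure (μ x))
  | succ l ih =>
    have := isProbabilityMeasure_checkMeas hrho h0 (evolve lam rho μ l) x
    have := isProbabilityMeasure_mixture hlam
      (m := measPow (checkMeas rho (evolve lam rho μ l) x)) fun j _ => inferInstance
    unfold evolve
    infer_instance

theorem map_signedMeasure_sub {X Z : Type*} [MeasurableSpace X] [MeasurableSpace Z] {f : X → Z}
    (hf : Measurable f) (μ ν : SignedMeasure X) : (μ - ν).map f = μ.map f - ν.map f := by
  ext s hs
  simp [VectorMeasure.map_apply _ hf hs]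

theorem linearCheck_toSignedMeasure {rho : ℝ[X]} (hrho : ∀ j, 0 ≤ rho.coeff j)
    (μ : ZMod 2 → Measure EReal) [∀ x, IsProbabilityMeasure (μ x)] (x : ZMod 2)
    [IsFiniteMeasure (checkMeas rho μ x)] :
    linearCheck rho (fun y => (μ y).toSignedMeasure) x = (checkMeas rho μ x).toSignedMeasure := by
  rw [linearCheck, Gam, Gam, VectorMeasure.map_smul, VectorMeasure.map_smul,
    VectorMeasure.map_add, map_signedMeasure_sub measurable_gam,
    map_toSignedMeasure measurable_gam, map_toSignedMeasure measurable_gam,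
    polyConv_half_add_half_sub (fun y => (μ y).map gam) hrho, GamInv,
    map_toSignedMeasure measurable_gamInv]
  rfl

theorem linearDensity_eq {Y : Type*} [MeasurableSpace Y] (W : ZMod 2 → ProbabilityMeasure Y)
    {lam rho : ℝ[X]} (hlam : IsDegreeDistribution lam)
    (hrho : IsDegreeDistribution rho) (h0 : rho.coeff 0 = 0) (μ : ZMod 2 → Measure EReal)
    [∀ x, IsProbabilityMeasure (μ x)] (hμ : ∀ x, initialDensity W x = (μ x).toSignedMeasure)
    (l : ℕ) (x : ZMod 2) [∀ l x, IsFiniteMeasure (evolve lam rho μ l x)] :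
    linearDensity W lam rho l x = (evolve lam rho μ l x).toSignedMeasure := by
  induction l generalizing x with
  | zero => exact hμ x
  | succ l ih =>
    have := isProbabilityMeasure_evolve hlam hrho h0 μ l
    have := isProbabilityMeasure_checkMeas hrho h0 (evolve lam rho μ l) x
    rw [linearDensity, hμ, funext ih, linearCheck_toSignedMeasure hrho.1,
      polyConv_toSignedMeasure hlam.1, sconv_toSignedMeasure]
    rfl

theorem cosetDensity_eq {Y : Type*} [MeasurableSpace Y] (W : ZMod 2 → ProbabilityMeasure Y)
    {lam rho : ℝ[X]} (hlam : IsDegreeDistribution lam)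
    (hrho : IsDegreeDistribution rho) (h0 : rho.coeff 0 = 0) (μ : Measure EReal)
    [IsProbabilityMeasure μ] (hμ : avg (initialDensity W) = μ.toSignedMeasure)
    (l : ℕ) (x : ZMod 2) [∀ l x, IsFiniteMeasure (evolve lam rho (fun _ => μ) l x)] :
    cosetDensity W lam rho l = (evolve lam rho (fun _ => μ) l x).toSignedMeasure := by
  induction l generalizing x with
  | zero => exact hμ
  | succ l ih =>
    have := isProbabilityMeasure_evolve hlam hrho h0 (fun _ => μ) l
    have hc := isProbabilityMeasure_checkMeas hrho h0 (evolve lam rho (fun _ => μ) l) x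
    have key : GamInv (polyConv rho (Gam (cosetDensity W lam rho l))) =
        (checkMeas rho (evolve lam rho (fun _ => μ) l) x).toSignedMeasure := by
      -- Independence of the input comes from the induction hypothesis: the laws for all inputs
      -- represent the same signed measure.
      have hx (y : ZMod 2) : evolve lam rho (fun _ => μ) l y = evolve lam rho (fun _ => μ) l x :=
        (Measure.toSignedMeasure_eq_toSignedMeasure_iff).1 ((ih y).symm.trans (ih x))
      rw [ih x, Gam, map_toSignedMeasure measurable_gam, polyConv_toSignedMeasure hrho.1, GamInv,
        map_toSignedMeasure measurable_gamInv]
      refine Measure.toSignedMeasure_congr ?_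
      rw [checkMeas, mixture, mixture]
      congr 1
      refine Finset.sum_congr rfl fun j hj => ?_
      obtain ⟨j, rfl⟩ := Nat.exists_eq_succ_of_ne_zero
        (show j ≠ 0 by rintro rfl; simp [h0] at hj)
      simp only [hx]
      rw [parityPow_const]
    rw [cosetDensity, hμ, key, polyConv_toSignedMeasure hlam.1, sconv_toSignedMeasure]
    rfl

/-! ### The functional `𝔼 |tanh (m / 2)|` -/

/-- `r ↦ tanh (r / 2)` on `[0, ∞]`. -/
def tanhHalf (r : ℝ≥0∞) : ℝ≥0∞ :=
  if r = ⊤ then 1 else ENNReal.ofReal (Real.tanh (r.toReal / 2))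

/-- `r ↦ exp (-r)` on `[0, ∞]`. -/
def expNeg (r : ℝ≥0∞) : ℝ≥0∞ :=
  if r = ⊤ then 0 else ENNReal.ofReal (Real.exp (-r.toReal))

/-- `m ↦ |tanh (m / 2)|` on `[-∞, ∞]`. -/
def absTanh (m : EReal) : ℝ≥0∞ := tanhHalf m.abs

theorem real_tanh_half (x : ℝ) :
    Real.tanh (x / 2) = (Real.exp x - 1) / (Real.exp x + 1) := by
  have h : Real.exp x = Real.exp (x / 2) * Real.exp (x / 2) := by
    rw [← Real.exp_add, add_halves]
  have h1 := Real.exp_pos (x / 2)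
  rw [Real.tanh_eq, Real.exp_neg, h]
  field_simp

theorem measurable_tanhHalf : Measurable tanhHalf := by
  refine Measurable.ite (measurableSet_singleton _) measurable_const ?_
  simp only [real_tanh_half]
  fun_prop

theorem measurable_expNeg : Measurable expNeg :=
  Measurable.ite (measurableSet_singleton _) measurable_const (by fun_prop)

theorem measurable_absTanh : Measurable absTanh :=
  measurable_tanhHalf.comp measurable_ereal_abs

theorem expNeg_add (r s : ℝ≥0∞) : expNeg (r + s) = expNeg r * expNeg s := by
  by_cases hr : r = ⊤
  · simp [expNeg, hr]
  by_cases hs : s = ⊤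
  · simp [expNeg, hs]
  simp only [expNeg, hr, hs, ENNReal.add_eq_top, or_self, if_false]
  rw [ENNReal.toReal_add hr hs, neg_add, Real.exp_add, ENNReal.ofReal_mul (Real.exp_pos _).le]

/-- `lnCoth` exchanges `tanh (r / 2)` and `exp (-r)`, since `(cosh - sinh) / (cosh + sinh)` at `r /
2` equals `exp (-r)`. With `expNeg_add` this makes `|tanh (m / 2)|` multiplicative at check nodes.
-/
theorem tanhHalf_lnCoth (r : ℝ≥0∞) : tanhHalf (lnCoth r) = expNeg r := by
  by_cases h0 : r = 0
  · simp [h0, lnCoth, tanhHalf, expNeg]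
  by_cases hr : r = ⊤
  · simp [hr, lnCoth, tanhHalf, expNeg]
  have hpos : 0 < r.toReal := ENNReal.toReal_pos h0 hr
  have hs : 0 < Real.sinh (r.toReal / 2) := Real.sinh_pos_iff.2 (by positivity)
  have hc := Real.cosh_pos (r.toReal / 2)
  have hlt := Real.sinh_lt_cosh (r.toReal / 2)
  simp only [tanhHalf, lnCoth, expNeg, h0, hr, if_false, ENNReal.ofReal_ne_top]
  rw [ENNReal.toReal_ofReal (Real.log_nonneg ((one_le_div hs).2 hlt.le)), real_tanh_half,
    Real.exp_log (by positivity)]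
  congr 1
  have e1 := Real.cosh_sub_sinh (r.toReal / 2)
  have e2 := Real.cosh_add_sinh (r.toReal / 2)
  rw [div_sub_one hs.ne', div_add_one hs.ne', div_div_div_cancel_right₀ hs.ne', e1, e2,
    ← Real.exp_sub]
  congr 1
  ring

theorem expNeg_lnCoth (r : ℝ≥0∞) : expNeg (lnCoth r) = tanhHalf r := by
  by_cases h0 : r = 0
  · simp [h0, lnCoth, tanhHalf, expNeg]
  by_cases hr : r = ⊤
  · simp [hr, lnCoth, tanhHalf, expNeg]
  have hpos : 0 < r.toReal := ENNReal.toReal_pos h0 hr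
  have hs : 0 < Real.sinh (r.toReal / 2) := Real.sinh_pos_iff.2 (by positivity)
  have hc := Real.cosh_pos (r.toReal / 2)
  have hlt := Real.sinh_lt_cosh (r.toReal / 2)
  simp only [tanhHalf, lnCoth, expNeg, h0, hr, if_false, ENNReal.ofReal_ne_top]
  rw [ENNReal.toReal_ofReal (Real.log_nonneg ((one_le_div hs).2 hlt.le)), Real.exp_neg,
    Real.exp_log (by positivity), Real.tanh_eq_sinh_div_cosh, inv_div]

theorem expNeg_gam (m : EReal) : expNeg (gam m).2 = absTanh m := expNeg_lnCoth _

theorem absTanh_gamInv (p : ZMod 2 × ℝ≥0∞) : absTanh (gamInv p) = expNeg p.2 := by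
  have habs (r : ℝ≥0∞) : (r : EReal).abs = r := by
    induction r with
    | top => rfl
    | coe r =>
      change ((r : ℝ) : EReal).abs = _
      rw [EReal.abs_def, abs_of_nonneg r.coe_nonneg, ENNReal.ofReal_coe_nnreal]
  rw [absTanh, gamInv]
  split_ifs
  · rw [habs, tanhHalf_lnCoth]
  · rw [EReal.abs_neg, habs, tanhHalf_lnCoth]

theorem tanhHalf_le_one (r : ℝ≥0∞) : tanhHalf r ≤ 1 := by
  unfold tanhHalf
  split_ifs
  · exact le_rfl
  · exact ENNReal.ofReal_le_one.2 (Real.tanh_lt_one _).le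

theorem absTanh_le_one (m : EReal) : absTanh m ≤ 1 := tanhHalf_le_one _

theorem absTanh_top : absTanh ⊤ = 1 := by simp [absTanh, tanhHalf]

theorem absTanh_bot : absTanh ⊥ = 1 := by simp [absTanh, tanhHalf]

theorem absTanh_zero : absTanh 0 = 0 := by simp [absTanh, tanhHalf]

theorem absTanh_coe (a : ℝ) : absTanh a = ENNReal.ofReal (Real.tanh (|a| / 2)) := by
  simp [absTanh, tanhHalf, EReal.abs_def]

theorem absTanh_coe_lt_one (a : ℝ) : absTanh a < 1 := by
  rw [absTanh_coe]
  exact ENNReal.ofReal_lt_one.2 (Real.tanh_lt_one _)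

theorem real_tanh_half_abs_add_le (a b : ℝ) :
    Real.tanh (|a + b| / 2) ≤ Real.tanh (|a| / 2) + Real.tanh (|b| / 2) := by
  have h1 : Real.exp |a + b| ≤ Real.exp |a| * Real.exp |b| := by
    rw [← Real.exp_add]
    exact Real.exp_le_exp.2 (abs_add_le a b)
  have ha : 1 ≤ Real.exp |a| := Real.one_le_exp (abs_nonneg a)
  have hb : 1 ≤ Real.exp |b| := Real.one_le_exp (abs_nonneg b)
  have hab : 1 ≤ Real.exp |a + b| := Real.one_le_exp (abs_nonneg _)
  simp only [real_tanh_half]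
  generalize Real.exp |a| = x at *
  generalize Real.exp |b| = y at *
  generalize Real.exp |a + b| = z at *
  calc (z - 1) / (z + 1) ≤ (x * y - 1) / (x * y + 1) := by
        rw [div_le_div_iff₀ (by linarith) (by nlinarith)]
        nlinarith
    _ ≤ (x - 1) / (x + 1) + (y - 1) / (y + 1) := by
        rw [div_add_div _ _ (by linarith) (by linarith),
          div_le_div_iff₀ (by nlinarith) (by nlinarith)]
        -- After clearing denominators, this product is the difference of the two sides.
        have : 0 ≤ (x - 1) * (y - 1) * (x * y - 1) :=
          mul_nonneg (mul_nonneg (by linarith) (by linarith)) (by nlinarith)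
        nlinarith

/-- Finite messages reduce to the real inequality. An infinite summand already contributes 1, so the
value assigned to `⊤ + ⊥` is immaterial. -/
theorem absTanh_add_le (a b : EReal) : absTanh (a + b) ≤ absTanh a + absTanh b := by
  induction a with
  | bot => rw [absTanh_bot]; exact (absTanh_le_one _).trans le_self_add
  | top => rw [absTanh_top]; exact (absTanh_le_one _).trans le_self_add
  | coe a =>
    induction b with
    | bot => rw [absTanh_bot]; exact (absTanh_le_one _).trans le_add_self
    | top => rw [absTanh_top]; exact (absTanh_le_one _).trans le_add_self
    | coe b =>
      rw [← EReal.coe_add, absTanh_coe, absTanh_coe, absTanh_coe]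
      exact (ENNReal.ofReal_le_ofReal (real_tanh_half_abs_add_le a b)).trans
        ENNReal.ofReal_add_le

/-- From `1 + t ≤ exp t` one gets `t / (t + 2) ≤ tanh (t / 2)`, and `4t / (t + 2)` is at least `t`
for `t ≤ 2` and at least 2 beyond. -/
theorem ofReal_min_two_abs_le (b : ℝ) : ENNReal.ofReal (min 2 |b|) ≤ 4 * absTanh b := by
  rw [absTanh_coe, show (4 : ℝ≥0∞) = ENNReal.ofReal 4 by simp,
    ← ENNReal.ofReal_mul (by norm_num)]
  refine ENNReal.ofReal_le_ofReal ?_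
  have h0 : 0 ≤ |b| := abs_nonneg b
  have he := Real.add_one_le_exp |b|
  rw [real_tanh_half]
  generalize Real.exp |b| = z at *
  generalize |b| = t at *
  have : t / (t + 2) ≤ (z - 1) / (z + 1) := by
    rw [div_le_div_iff₀ (by linarith) (by linarith)]
    nlinarith
  refine le_trans ?_ (mul_le_mul_of_nonneg_left this (by norm_num))
  rw [← mul_div_assoc, le_div_iff₀ (by linarith)]
  rcases le_total t 2 with h | h
  · rw [min_eq_right h]; nlinarith
  · rw [min_eq_left h]; nlinarith

/-! ### Moduli of continuity for test functions -/

theorem IsBLTest.measurable {f : EReal → ℝ} (hf : IsBLTest f) : Measurable f := by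
  refine EReal.measurable_of_measurable_real (Continuous.measurable ?_)
  refine LipschitzWith.continuous (K := 1) (LipschitzWith.of_dist_le_mul fun a b => ?_)
  simpa [Real.dist_eq] using hf.2 a b

theorem enorm_sub_le_two {x y : ℝ} (hx : |x| ≤ 1) (hy : |y| ≤ 1) : ‖x - y‖ₑ ≤ 2 := by
  rw [← ofReal_norm, Real.norm_eq_abs, show (2 : ℝ≥0∞) = ENNReal.ofReal 2 by simp]
  exact ENNReal.ofReal_le_ofReal ((abs_sub _ _).trans (by linarith))

/-- No continuity at `±∞` is needed: a finite `b` leaves an infinite `a` unchanged, and an infinite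
`b` has strength 1. -/
theorem IsBLTest.enorm_sub_le {f : EReal → ℝ} (hf : IsBLTest f) (a b : EReal) :
    ‖f (a + b) - f a‖ₑ ≤ 4 * absTanh b := by
  have h2 := enorm_sub_le_two (hf.1 (a + b)) (hf.1 a)
  have h24 : (2 : ℝ≥0∞) ≤ 4 := by norm_num
  induction b with
  | bot => rw [absTanh_bot, mul_one]; exact h2.trans h24
  | top => rw [absTanh_top, mul_one]; exact h2.trans h24
  | coe b =>
    refine le_trans ?_ (ofReal_min_two_abs_le b)
    induction a with
    | bot => simp
    | top => simp
    | coe a =>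
      rw [← ofReal_norm, Real.norm_eq_abs]
      refine ENNReal.ofReal_le_ofReal (le_min ?_ ?_)
      · exact (abs_sub _ _).trans (by linarith [hf.1 (a + b), hf.1 a])
      · rw [← EReal.coe_add]
        simpa using hf.2 (a + b) a

/-- Addition is continuous at `(a, 0)` for every `a`, so compactness of `[-∞, ∞]` gives one `δ` for
all `a`. For larger `b` the trivial bound `2B` is absorbed by `K`, as `absTanh b` is then at least
`δ / 4`. -/
theorem exists_enorm_sub_le_of_continuous {f : EReal → ℝ} (hf : Continuous f) {B : ℝ}
    (hB : ∀ m, |f m| ≤ B) {ε : ℝ≥0∞} (hε : ε ≠ 0) :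
    ∃ K : ℝ≥0∞, K ≠ ⊤ ∧ ∀ a b, ‖f (a + b) - f a‖ₑ ≤ ε + K * absTanh b := by
  have hcont (a : EReal) : ContinuousAt (fun p : EReal × EReal => ‖f (p.2 + p.1) - f p.2‖ₑ)
      (0, a) := by
    have h1 : ContinuousAt (fun p : EReal × EReal => p.2 + p.1) (0, a) :=
      (EReal.continuousAt_add (p := (a, 0)) (by simp) (by simp)).comp (x := (0, a))
        continuous_swap.continuousAt
    have h2 : ContinuousAt (fun p : EReal × EReal => f (p.2 + p.1)) (0, a) :=
      hf.continuousAt.comp h1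
    exact (h2.sub (hf.comp continuous_snd).continuousAt).enorm
  have hev : ∀ᶠ b in 𝓝 (0 : EReal), ∀ a ∈ (Set.univ : Set EReal), ‖f (a + b) - f a‖ₑ < ε := by
    refine isCompact_univ.eventually_forall_of_forall_eventually fun a _ => ?_
    exact Filter.Tendsto.eventually_lt_const (by simpa using hε.bot_lt) (hcont a)
  -- The cap `δ ≤ 2` matches the truncation in `ofReal_min_two_abs_le`.
  obtain ⟨δ, hδ, hδ2, hball⟩ : ∃ δ : ℝ, 0 < δ ∧ δ ≤ 2 ∧ ∀ b : ℝ, |b| < δ →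
      ∀ a, ‖f (a + b) - f a‖ₑ < ε := by
    have h : ∀ᶠ b : ℝ in 𝓝 0, ∀ a ∈ (Set.univ : Set EReal), ‖f (a + b) - f a‖ₑ < ε :=
      continuous_coe_real_ereal.continuousAt.eventually (by rw [EReal.coe_zero]; exact hev)
    obtain ⟨δ, hδ, h⟩ := Metric.eventually_nhds_iff.1 h
    exact ⟨min δ 2, by positivity, min_le_right _ _, fun b hb a =>
      h (by simpa using hb.trans_le (min_le_left _ _)) a trivial⟩
  have hbound (a b : EReal) : ‖f (a + b) - f a‖ₑ ≤ ENNReal.ofReal (2 * B) := by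
    rw [← ofReal_norm, Real.norm_eq_abs]
    exact ENNReal.ofReal_le_ofReal ((abs_sub _ _).trans (by linarith [hB (a + b), hB a]))
  refine ⟨ENNReal.ofReal (2 * B) * (4 / ENNReal.ofReal δ), ?_, fun a b => ?_⟩
  · exact ENNReal.mul_ne_top ENNReal.ofReal_ne_top
      (ENNReal.div_ne_top (by simp) (by simpa using hδ))
  have hfar (h : ENNReal.ofReal δ ≤ 4 * absTanh b) : ‖f (a + b) - f a‖ₑ ≤
      ε + ENNReal.ofReal (2 * B) * (4 / ENNReal.ofReal δ) * absTanh b := by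
    refine (hbound a b).trans (le_add_left ?_)
    rw [mul_assoc, ← ENNReal.mul_div_right_comm]
    refine le_mul_of_one_le_right' ?_
    rwa [ENNReal.le_div_iff_mul_le (by simp [hδ]) (by simp), one_mul]
  have h4 : ENNReal.ofReal δ ≤ 4 * 1 := by
    rw [mul_one, show (4 : ℝ≥0∞) = ENNReal.ofReal 4 by simp]
    exact ENNReal.ofReal_le_ofReal (by linarith)
  induction b with
  | bot => exact hfar (by rwa [absTanh_bot])
  | top => exact hfar (by rwa [absTanh_top])
  | coe b =>
    by_cases hb : |b| < δ
    · exact (hball b hb a).le.trans le_self_add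
    · refine hfar (le_trans (ENNReal.ofReal_le_ofReal ?_) (ofReal_min_two_abs_le b))
      exact le_min hδ2 (not_lt.1 hb)

/-! ### Estimates for one step of the evolution -/

theorem lintegral_mixture {X : Type*} [MeasurableSpace X] (p : ℝ[X]) (m : ℕ → Measure X)
    (g : X → ℝ≥0∞) :
    ∫⁻ a, g a ∂mixture p m = ∑ j ∈ p.support, ENNReal.ofReal (p.coeff j) * ∫⁻ a, g a ∂m j := by
  rw [mixture, lintegral_finsetSum_measure]
  simp [lintegral_smul_measure]

theorem lintegral_absTanh_conv_le (μ ν : Measure EReal) [IsProbabilityMeasure μ]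
    [IsProbabilityMeasure ν] :
    ∫⁻ m, absTanh m ∂μ.conv ν ≤ ∫⁻ m, absTanh m ∂μ + ∫⁻ m, absTanh m ∂ν := by
  rw [Measure.lintegral_conv measurable_absTanh]
  calc ∫⁻ a, ∫⁻ b, absTanh (a + b) ∂ν ∂μ
      ≤ ∫⁻ a, ∫⁻ b, (absTanh a + absTanh b) ∂ν ∂μ :=
        lintegral_mono fun a => lintegral_mono fun b => absTanh_add_le a b
    _ = ∫⁻ m, absTanh m ∂μ + ∫⁻ m, absTanh m ∂ν := by
        simp [lintegral_add_left measurable_absTanh, lintegral_add_left measurable_const]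

theorem lintegral_absTanh_measPow_le (ν : Measure EReal) [IsProbabilityMeasure ν] (n : ℕ) :
    ∫⁻ m, absTanh m ∂measPow ν n ≤ n * ∫⁻ m, absTanh m ∂ν := by
  induction n with
  | zero => simp [measPow, lintegral_dirac' _ measurable_absTanh, absTanh_zero]
  | succ n ih =>
    rw [measPow, Nat.cast_succ, add_mul, one_mul]
    exact (lintegral_absTanh_conv_le _ _).trans (add_le_add_left ih _)

/-- The mean number `∑ⱼ j pⱼ` of convolution factors. -/
def meanExponent (p : ℝ[X]) : ℝ≥0∞ :=
  ∑ j ∈ p.support, ENNReal.ofReal (p.coeff j) * j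

theorem meanExponent_ne_top (p : ℝ[X]) : meanExponent p ≠ ⊤ :=
  ENNReal.sum_ne_top.2 fun _ _ => ENNReal.mul_ne_top ENNReal.ofReal_ne_top (by simp)

theorem lintegral_absTanh_mixture_measPow_le (p : ℝ[X]) (ν : Measure EReal)
    [IsProbabilityMeasure ν] :
    ∫⁻ m, absTanh m ∂mixture p (measPow ν) ≤ meanExponent p * ∫⁻ m, absTanh m ∂ν := by
  rw [lintegral_mixture, meanExponent, Finset.sum_mul]
  refine Finset.sum_le_sum fun j _ => ?_
  rw [mul_assoc]
  exact mul_le_mul_right (lintegral_absTanh_measPow_le ν j) _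

/-- The average of two laws. -/
def avgMeas (μ : ZMod 2 → Measure EReal) : Measure EReal := (2⁻¹ : ℝ≥0∞) • (μ 0 + μ 1)

instance (μ : ZMod 2 → Measure EReal) [∀ x, IsProbabilityMeasure (μ x)] :
    IsProbabilityMeasure (avgMeas μ) := by
  constructor
  simp only [avgMeas, Measure.smul_apply, Measure.add_apply, measure_univ, smul_eq_mul,
    one_add_one_eq_two]
  exact ENNReal.inv_mul_cancel (by simp) (by simp)

theorem avgMeas_const (μ : Measure EReal) : avgMeas (fun _ => μ) = μ := by
  rw [avgMeas, ← two_smul ℝ≥0∞ μ, smul_smul, ENNReal.inv_mul_cancel (by simp) (by simp), one_smul]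

theorem toSignedMeasure_avgMeas (μ : ZMod 2 → Measure EReal) [∀ x, IsProbabilityMeasure (μ x)] :
    (avgMeas μ).toSignedMeasure =
      (1 / 2 : ℝ) • ((μ 0).toSignedMeasure + (μ 1).toSignedMeasure) := by
  have : IsFiniteMeasure ((2⁻¹ : ℝ≥0∞) • (μ 0 + μ 1)) := Measure.smul_finite _ (by simp)
  exact toSignedMeasure_half_smul_add _ _

/-- The mean of `|tanh (m / 2)|` under the average of two laws. -/
def meanTanh (μ : ZMod 2 → Measure EReal) : ℝ≥0∞ := ∫⁻ m, absTanh m ∂avgMeas μ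

theorem meanTanh_eq (μ : ZMod 2 → Measure EReal) :
    meanTanh μ = 2⁻¹ * (∫⁻ m, absTanh m ∂μ 0 + ∫⁻ m, absTanh m ∂μ 1) := by
  rw [meanTanh, avgMeas, lintegral_smul_measure, lintegral_add_measure, smul_eq_mul]

theorem meanTanh_le_one (μ : ZMod 2 → Measure EReal) [∀ x, IsProbabilityMeasure (μ x)] :
    meanTanh μ ≤ 1 := by
  refine (lintegral_mono absTanh_le_one).trans ?_
  simp

/-- `exp (-r)` is multiplicative under convolution, and summing over the parity removes the
conditioning. Only this sum has a closed form in `meanTanh`, so later estimates concern averages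
over the input. -/
theorem lintegral_expNeg_parityPow_add (μ : ZMod 2 → Measure EReal)
    [∀ x, IsProbabilityMeasure (μ x)] (n : ℕ) :
    ∫⁻ p, expNeg p.2 ∂parityPow (fun y => (μ y).map gam) n 0 +
      ∫⁻ p, expNeg p.2 ∂parityPow (fun y => (μ y).map gam) n 1 = 2 * meanTanh μ ^ n := by
  have hm : Measurable fun p : ZMod 2 × ℝ≥0∞ => expNeg p.2 :=
    measurable_expNeg.comp measurable_snd
  have hU (x : ZMod 2) : ∫⁻ p, expNeg p.2 ∂(μ x).map gam = ∫⁻ m, absTanh m ∂μ x := by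
    rw [lintegral_map hm measurable_gam]
    simp only [expNeg_gam]
  have hconv (κ ν : Measure (ZMod 2 × ℝ≥0∞)) [IsFiniteMeasure κ] [IsFiniteMeasure ν] :
      ∫⁻ p, expNeg p.2 ∂κ.conv ν = (∫⁻ p, expNeg p.2 ∂κ) * ∫⁻ p, expNeg p.2 ∂ν := by
    rw [Measure.lintegral_conv hm]
    simp only [Prod.snd_add, expNeg_add]
    simp only [lintegral_const_mul _ hm, lintegral_mul_const _ hm]
  induction n with
  | zero => simp [parityPow, expNeg]
  | succ n ih =>
    simp only [parityPow, lintegral_smul_measure, lintegral_add_measure, hconv, hU, smul_eq_mul,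
      show (0 : ZMod 2) + 1 = 1 from rfl, show (1 : ZMod 2) + 1 = 0 from rfl]
    rw [pow_succ, ← mul_assoc, ← ih, meanTanh_eq]
    ring

theorem lintegral_absTanh_checkMeas_add_le {rho : ℝ[X]} (hrho : IsDegreeDistribution rho) {Δ : ℕ}
    (h0 : ∀ j < Δ, rho.coeff j = 0) (μ : ZMod 2 → Measure EReal)
    [∀ x, IsProbabilityMeasure (μ x)] :
    ∫⁻ m, absTanh m ∂checkMeas rho μ 0 + ∫⁻ m, absTanh m ∂checkMeas rho μ 1 ≤
      2 * meanTanh μ ^ Δ := by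
  simp only [checkMeas, lintegral_map measurable_absTanh measurable_gamInv, absTanh_gamInv,
    lintegral_mixture]
  rw [← Finset.sum_add_distrib]
  simp only [← mul_add, lintegral_expNeg_parityPow_add]
  calc ∑ j ∈ rho.support, ENNReal.ofReal (rho.coeff j) * (2 * meanTanh μ ^ j)
      ≤ ∑ j ∈ rho.support, ENNReal.ofReal (rho.coeff j) * (2 * meanTanh μ ^ Δ) := by
        refine Finset.sum_le_sum fun j hj => ?_
        have hj : Δ ≤ j := not_lt.1 fun h => Polynomial.mem_support_iff.1 hj (h0 j h)
        refine mul_le_mul_right (mul_le_mul_right ?_ _) _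
        exact pow_le_pow_right_of_le_one' (meanTanh_le_one μ) hj
    _ = 2 * meanTanh μ ^ Δ := by rw [← Finset.sum_mul, hrho.sum_eq_one, one_mul]

/-- Both integrals are taken over the product measure, coupling `a + b` with `a`. -/
theorem enorm_integral_conv_sub_le (μ ν : Measure EReal) [IsProbabilityMeasure μ]
    [IsProbabilityMeasure ν] {f : EReal → ℝ} (hf : Measurable f) {B : ℝ} (hB : ∀ m, |f m| ≤ B)
    {ε K : ℝ≥0∞} (h : ∀ a b, ‖f (a + b) - f a‖ₑ ≤ ε + K * absTanh b) :
    ‖∫ m, f m ∂μ.conv ν - ∫ m, f m ∂μ‖ₑ ≤ ε + K * ∫⁻ m, absTanh m ∂ν := by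
  have hadd : Measurable fun p : EReal × EReal => p.1 + p.2 := measurable_add
  have h1 : ∫ m, f m ∂μ.conv ν = ∫ p, f (p.1 + p.2) ∂μ.prod ν := by
    rw [Measure.conv, integral_map hadd.aemeasurable hf.aestronglyMeasurable]
  have h2 : ∫ m, f m ∂μ = ∫ p, f p.1 ∂μ.prod ν := by
    rw [integral_fun_fst]
    simp
  have hint (g : EReal × EReal → EReal) (hg : Measurable g) :
      Integrable (fun p => f (g p)) (μ.prod ν) :=
    Integrable.of_bound (hf.comp hg).aestronglyMeasurable B (ae_of_all _ fun p => hB (g p))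
  rw [h1, h2, ← integral_sub (hint _ hadd) (hint _ measurable_fst)]
  calc ‖∫ p : EReal × EReal, (f (p.1 + p.2) - f p.1) ∂μ.prod ν‖ₑ
      ≤ ∫⁻ p : EReal × EReal, ‖f (p.1 + p.2) - f p.1‖ₑ ∂μ.prod ν :=
        enorm_integral_le_lintegral_enorm _
    _ ≤ ∫⁻ p : EReal × EReal, (ε + K * absTanh p.2) ∂μ.prod ν := lintegral_mono fun p => h _ _
    _ = ε + K * ∫⁻ m, absTanh m ∂ν := by
        rw [lintegral_add_left measurable_const, lintegral_const_mul K
          (show Measurable fun p : EReal × EReal => absTanh p.2 from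
            measurable_absTanh.comp measurable_snd), lintegral_const, measure_univ, mul_one]
        congr 2
        rw [← lintegral_map measurable_absTanh measurable_snd]
        simp

theorem integral_avgMeas (μ : ZMod 2 → Measure EReal) [∀ x, IsProbabilityMeasure (μ x)]
    {f : EReal → ℝ} (hf : Measurable f) {B : ℝ} (hB : ∀ m, |f m| ≤ B) :
    ∫ m, f m ∂avgMeas μ = 2⁻¹ * (∫ m, f m ∂μ 0 + ∫ m, f m ∂μ 1) := by
  have hint (x : ZMod 2) : Integrable f (μ x) :=
    Integrable.of_bound hf.aestronglyMeasurable B (ae_of_all _ hB)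
  rw [avgMeas, integral_smul_measure, integral_add_measure (hint 0) (hint 1)]
  simp

section Evolve

variable {lam rho : ℝ[X]} (hlam : IsDegreeDistribution lam) (hrho : IsDegreeDistribution rho)
  {Δ : ℕ} (hΔ : 1 ≤ Δ) (h0 : ∀ j < Δ, rho.coeff j = 0) (μ : ZMod 2 → Measure EReal)
  [∀ x, IsProbabilityMeasure (μ x)]

include hlam hrho hΔ h0

/-- Every iteration restarts from the fresh channel law `μ`, so its contribution does not accumulate
with `l`. -/
theorem meanTanh_evolve_succ_le (l : ℕ) :
    meanTanh (evolve lam rho μ (l + 1)) ≤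
      meanTanh μ + meanExponent lam * meanTanh (evolve lam rho μ l) ^ Δ := by
  have hP := isProbabilityMeasure_evolve hlam hrho (h0 0 hΔ) μ l
  have hQ := isProbabilityMeasure_checkMeas hrho (h0 0 hΔ) (evolve lam rho μ l)
  have hM (x : ZMod 2) := isProbabilityMeasure_mixture hlam
    (m := measPow (checkMeas rho (evolve lam rho μ l) x)) fun j _ => inferInstance
  have hx (x : ZMod 2) : ∫⁻ m, absTanh m ∂evolve lam rho μ (l + 1) x ≤ ∫⁻ m, absTanh m ∂μ x +
      meanExponent lam * ∫⁻ m, absTanh m ∂checkMeas rho (evolve lam rho μ l) x :=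
    (lintegral_absTanh_conv_le _ _).trans
      (add_le_add_right (lintegral_absTanh_mixture_measPow_le _ _) _)
  have hc := lintegral_absTanh_checkMeas_add_le hrho h0 (evolve lam rho μ l)
  rw [meanTanh_eq, meanTanh_eq]
  calc _ ≤ 2⁻¹ * ((∫⁻ m, absTanh m ∂μ 0 +
        meanExponent lam * ∫⁻ m, absTanh m ∂checkMeas rho (evolve lam rho μ l) 0) +
        (∫⁻ m, absTanh m ∂μ 1 +
        meanExponent lam * ∫⁻ m, absTanh m ∂checkMeas rho (evolve lam rho μ l) 1)) := by
        gcongr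
        · exact hx 0
        · exact hx 1
    _ = 2⁻¹ * (∫⁻ m, absTanh m ∂μ 0 + ∫⁻ m, absTanh m ∂μ 1) + meanExponent lam * (2⁻¹ *
        (∫⁻ m, absTanh m ∂checkMeas rho (evolve lam rho μ l) 0 +
          ∫⁻ m, absTanh m ∂checkMeas rho (evolve lam rho μ l) 1)) := by ring
    _ ≤ _ := by
        gcongr
        refine (mul_le_mul_right hc _).trans ?_
        rw [← mul_assoc, ENNReal.inv_mul_cancel (by simp) (by simp), one_mul]

theorem enorm_integral_evolve_succ_sub_le {f : EReal → ℝ} (hf : Measurable f) {B : ℝ}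
    (hB : ∀ m, |f m| ≤ B) {ε K : ℝ≥0∞} (h : ∀ a b, ‖f (a + b) - f a‖ₑ ≤ ε + K * absTanh b)
    (l : ℕ) :
    ‖∫ m, f m ∂avgMeas (evolve lam rho μ (l + 1)) - ∫ m, f m ∂avgMeas μ‖ₑ ≤
      ε + K * (meanExponent lam * meanTanh (evolve lam rho μ l) ^ Δ) := by
  have hP := isProbabilityMeasure_evolve hlam hrho (h0 0 hΔ) μ l
  have hP' := isProbabilityMeasure_evolve hlam hrho (h0 0 hΔ) μ (l + 1)
  have hQ := isProbabilityMeasure_checkMeas hrho (h0 0 hΔ) (evolve lam rho μ l)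
  have hM (x : ZMod 2) := isProbabilityMeasure_mixture hlam
    (m := measPow (checkMeas rho (evolve lam rho μ l) x)) fun j _ => inferInstance
  have hx (x : ZMod 2) : ‖∫ m, f m ∂evolve lam rho μ (l + 1) x - ∫ m, f m ∂μ x‖ₑ ≤ ε + K *
      (meanExponent lam * ∫⁻ m, absTanh m ∂checkMeas rho (evolve lam rho μ l) x) := by
    refine (enorm_integral_conv_sub_le _ _ hf hB h).trans ?_
    gcongr
    exact lintegral_absTanh_mixture_measPow_le _ _
  have hc := lintegral_absTanh_checkMeas_add_le hrho h0 (evolve lam rho μ l)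
  have h2 : (2⁻¹ : ℝ≥0∞) * 2 = 1 := ENNReal.inv_mul_cancel (by simp) (by simp)
  have hhalf : ‖(2⁻¹ : ℝ)‖ₑ = 2⁻¹ := by
    rw [enorm_inv (by norm_num)]
    simp [← ofReal_norm]
  rw [integral_avgMeas _ hf hB, integral_avgMeas _ hf hB, ← mul_sub, add_sub_add_comm, enorm_mul,
    hhalf]
  calc _ ≤ 2⁻¹ * ((ε + K *
        (meanExponent lam * ∫⁻ m, absTanh m ∂checkMeas rho (evolve lam rho μ l) 0)) + (ε + K *
        (meanExponent lam * ∫⁻ m, absTanh m ∂checkMeas rho (evolve lam rho μ l) 1))) := by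
        gcongr
        exact (enorm_add_le _ _).trans (add_le_add (hx 0) (hx 1))
    _ = (2⁻¹ * 2) * ε + K * (meanExponent lam * (2⁻¹ *
        (∫⁻ m, absTanh m ∂checkMeas rho (evolve lam rho μ l) 0 +
          ∫⁻ m, absTanh m ∂checkMeas rho (evolve lam rho μ l) 1))) := by ring
    _ ≤ _ := by
        rw [h2, one_mul]
        gcongr
        refine (mul_le_mul_right hc _).trans ?_
        rw [← mul_assoc, h2, one_mul]

/-- The hypothesis `hθ` makes `[0, θ]` invariant under the one-step bound. -/
theorem meanTanh_evolve_le {θ : ℝ≥0∞} (hμ : meanTanh μ ≤ θ)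
    (hθ : meanTanh μ + meanExponent lam * θ ^ Δ ≤ θ) (l : ℕ) :
    meanTanh (evolve lam rho μ l) ≤ θ := by
  induction l with
  | zero => exact hμ
  | succ l ih =>
    refine (meanTanh_evolve_succ_le hlam hrho hΔ h0 μ l).trans (le_trans ?_ hθ)
    gcongr

theorem enorm_integral_evolve_sub_le {θ : ℝ≥0∞} (hμ : meanTanh μ ≤ θ)
    (hθ : meanTanh μ + meanExponent lam * θ ^ Δ ≤ θ) {f : EReal → ℝ} (hf : Measurable f) {B : ℝ}
    (hB : ∀ m, |f m| ≤ B) {ε K : ℝ≥0∞} (h : ∀ a b, ‖f (a + b) - f a‖ₑ ≤ ε + K * absTanh b)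
    (l : ℕ) :
    ‖∫ m, f m ∂avgMeas (evolve lam rho μ l) - ∫ m, f m ∂avgMeas μ‖ₑ ≤
      ε + K * (meanExponent lam * θ ^ Δ) := by
  cases l with
  | zero => simp [show evolve lam rho μ 0 = μ from rfl]
  | succ l =>
    refine (enorm_integral_evolve_succ_sub_le hlam hrho hΔ h0 μ hf hB h l).trans ?_
    gcongr
    exact meanTanh_evolve_le hlam hrho hΔ h0 μ hμ hθ l

end Evolve

/-! ### Noiseless channels -/

/-- The hypothesis excludes `⊤ + ⊥ = ⊥`. -/
theorem dirac_top_conv {ν : Measure EReal} [IsProbabilityMeasure ν] (h : ν {⊥} = 0) :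
    (Measure.dirac ⊤).conv ν = Measure.dirac ⊤ := by
  rw [Measure.dirac_conv, Measure.map_congr (g := fun _ => ⊤), Measure.map_const]
  · simp
  · filter_upwards [measure_eq_zero_iff_ae_notMem.1 h] with b hb
    exact EReal.top_add_of_ne_bot hb

theorem evolve_dirac_top {lam rho : ℝ[X]} (hlam : IsDegreeDistribution lam)
    (hrho : IsDegreeDistribution rho) (h0 : rho.coeff 0 = 0) (l : ℕ) (x : ZMod 2) :
    evolve lam rho (fun _ => Measure.dirac ⊤) l x = Measure.dirac ⊤ := by
  induction l generalizing x with
  | zero => rfl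
  | succ l ih =>
    -- `γ` sends certainty `⊤` to the neutral element, so check nodes with at least one input
    -- preserve it.
    have hgam : (Measure.dirac (⊤ : EReal)).map gam = Measure.dirac 0 := by
      rw [Measure.map_dirac' measurable_gam]
      rw [show gam ⊤ = 0 by simp [gam, lnCoth]]
    have hpow (n : ℕ) : measPow (Measure.dirac (0 : ZMod 2 × ℝ≥0∞)) n = Measure.dirac 0 := by
      induction n with
      | zero => rfl
      | succ n ih => rw [measPow, ih, Measure.dirac_conv_dirac, add_zero]
    have hmix : (mixture rho fun j => parityPow (fun _ => (Measure.dirac (⊤ : EReal)).map gam) j x) =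
        Measure.dirac 0 := by
      have (j : ℕ) (hj : j ∈ rho.support) :
          parityPow (fun _ => (Measure.dirac (⊤ : EReal)).map gam) j x = Measure.dirac 0 := by
        obtain ⟨j, rfl⟩ := Nat.exists_eq_succ_of_ne_zero
          (show j ≠ 0 by rintro rfl; simp [h0] at hj)
        rw [hgam, parityPow_const, hpow]
      rw [mixture, Finset.sum_congr rfl fun j hj => by rw [this j hj], ← Finset.sum_smul,
        hrho.sum_eq_one, one_smul]
    have hcheck : checkMeas rho (evolve lam rho (fun _ => Measure.dirac ⊤) l) x =
        Measure.dirac ⊤ := by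
      rw [checkMeas]
      simp only [ih]
      rw [hmix, Measure.map_dirac' measurable_gamInv]
      congr 1
      simp [gamInv, lnCoth]
    -- The power `n = 0` is `δ₀`, not `δ_⊤`, but it too has no mass at `⊥`; this is all that
    -- `dirac_top_conv` requires.
    have htop (n : ℕ) : measPow (Measure.dirac (⊤ : EReal)) n {⊥} = 0 := by
      cases n with
      | zero => simp [measPow]
      | succ n =>
        have : ∀ n, measPow (Measure.dirac (⊤ : EReal)) (n + 1) = Measure.dirac ⊤ := by
          intro n
          induction n with
          | zero => simp [measPow, Measure.dirac_conv_dirac]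
          | succ n ih => rw [measPow, ih, Measure.dirac_conv_dirac, EReal.top_add_top]
        simp [this]
    have := isProbabilityMeasure_mixture hlam (m := measPow (Measure.dirac (⊤ : EReal)))
      fun j _ => inferInstance
    rw [evolve, hcheck, dirac_top_conv]
    rw [mixture, Measure.finsetSum_apply]
    simp [htop]

/-- An integrand bounded by 1 with mean at least 1 equals 1 almost everywhere, and `absTanh` is 1
only at `±∞`. -/
theorem eq_dirac_top_of_lintegral_absTanh {μ : Measure EReal} [IsProbabilityMeasure μ]
    (h : 1 ≤ ∫⁻ m, absTanh m ∂μ) (hbot : μ {⊥} = 0) : μ = Measure.dirac ⊤ := by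
  have hae : ∀ᵐ m ∂μ, absTanh m = 1 := by
    have h1 : ∫⁻ m, absTanh m ∂μ ≤ ∫⁻ _, 1 ∂μ := lintegral_mono absTanh_le_one
    refine ae_eq_of_ae_le_of_lintegral_le (ae_of_all _ absTanh_le_one) ?_ aemeasurable_const ?_
    · exact ne_top_of_le_ne_top (by simp) h1
    · simpa using h
  have htop : ∀ᵐ m ∂μ, id m = (fun _ => ⊤ : EReal → EReal) m := by
    filter_upwards [hae, measure_eq_zero_iff_ae_notMem.1 hbot] with m hm hb
    induction m with
    | bot => simp at hb
    | top => rfl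
    | coe a => exact absurd hm (absTanh_coe_lt_one a).ne
  rw [← Measure.map_id (μ := μ), Measure.map_congr htop, Measure.map_const]
  simp

/-! ### The channel -/

section Channel

variable {Y : Type*} [MeasurableSpace Y] (W : ZMod 2 → ProbabilityMeasure Y)

theorem measurable_channelLLR (x : ZMod 2) : Measurable (channelLLR W x) :=
  ENNReal.measurable_log.comp
    ((Measure.measurable_rnDeriv _ _).div (Measure.measurable_rnDeriv _ _))

/-- The law of the log-likelihood ratio, as a positive measure. -/
def initialMeas (x : ZMod 2) : Measure EReal := (W x : Measure Y).map (channelLLR W x)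

instance (x : ZMod 2) : IsProbabilityMeasure (initialMeas W x) :=
  Measure.isProbabilityMeasure_map (measurable_channelLLR W x).aemeasurable

/-- The logarithm is `-∞` only if the ratio vanishes, but almost surely under `W x` the numerator is
positive and the denominator finite. -/
theorem initialMeas_bot (x : ZMod 2) : initialMeas W x {⊥} = 0 := by
  rw [initialMeas, Measure.map_apply (measurable_channelLLR W x) (measurableSet_singleton _)]
  have hac : (W x : Measure Y) ≪ (W 0 : Measure Y) + (W 1 : Measure Y) := by
    fin_cases x
    · exact Measure.AbsolutelyContinuous.rfl.add_right _
    · change (W 1 : Measure Y) ≪ _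
      rw [add_comm]
      exact Measure.AbsolutelyContinuous.rfl.add_right _
  refine measure_eq_zero_iff_ae_notMem.2 ?_
  filter_upwards [Measure.rnDeriv_pos hac, hac.ae_le (Measure.rnDeriv_lt_top
    (W (x + 1) : Measure Y) ((W 0 : Measure Y) + (W 1 : Measure Y)))] with y h1 h2
  simp [channelLLR, h1.ne', h2.ne]

end Channel

/-! ### Closeness in distribution -/

/-- `κ` and `ν` give nearly the same means to test functions: for a bounded measurable `f` with
`|f (a + b) - f a| ≤ ε + K |tanh (b / 2)|` the means differ by at most `ε + K r`. -/
def IsClose (κ ν : Measure EReal) (r : ℝ≥0∞) : Prop :=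
  ∀ f : EReal → ℝ, Measurable f → ∀ B : ℝ, (∀ m, |f m| ≤ B) → ∀ ε K : ℝ≥0∞,
    (∀ a b, ‖f (a + b) - f a‖ₑ ≤ ε + K * absTanh b) →
      ‖∫ m, f m ∂κ - ∫ m, f m ∂ν‖ₑ ≤ ε + K * r

theorem tendsto_of_isClose {P : ℕ → ProbabilityMeasure EReal} {ν : ProbabilityMeasure EReal}
    {r : ℕ → ℝ≥0∞} (hr : Tendsto r atTop (𝓝 0))
    (h : ∀ᶠ n in atTop, IsClose (P n : Measure EReal) ν (r n)) : Tendsto P atTop (𝓝 ν) := by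
  rw [ProbabilityMeasure.tendsto_iff_forall_integral_tendsto]
  intro f
  rw [tendsto_iff_edist_tendsto_0, ENNReal.tendsto_nhds_zero]
  intro ε hε
  have hB (m : EReal) : |f m| ≤ ‖f‖ := f.norm_coe_le_norm m
  have hε2 : ε / 2 ≠ 0 := by simp [hε.ne']
  -- `K` depends on `ε` and `f` but not on `n`, so `K * r n` still tends to 0.
  obtain ⟨K, hK, hfK⟩ := exists_enorm_sub_le_of_continuous f.continuous hB hε2
  have hKr : Tendsto (fun n => K * r n) atTop (𝓝 0) := by
    simpa using ENNReal.Tendsto.const_mul hr (Or.inr hK)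
  filter_upwards [h, ENNReal.tendsto_nhds_zero.1 hKr (ε / 2) hε2.bot_lt] with n hn hrn
  rw [edist_eq_enorm_sub]
  refine (hn f f.continuous.measurable _ hB _ _ hfK).trans ?_
  exact (add_le_add_right hrn _).trans (ENNReal.add_halves ε).le

theorem abs_integral_sub_le_of_isClose {κ κ' ν : Measure EReal} {r : ℝ≥0∞} (hr : r ≠ ⊤)
    (h : IsClose κ ν r) (h' : IsClose κ' ν r) {f : EReal → ℝ} (hf : IsBLTest f) :
    |(∫ m, f m ∂κ) - ∫ m, f m ∂κ'| ≤ 8 * r.toReal := by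
  have key {η : Measure EReal} (hη : IsClose η ν r) :
      |(∫ m, f m ∂η) - ∫ m, f m ∂ν| ≤ 4 * r.toReal := by
    have := hη f hf.measurable 1 hf.1 0 4 fun a b => by simpa using hf.enorm_sub_le a b
    rw [zero_add, ← ofReal_norm, Real.norm_eq_abs, ENNReal.ofReal_le_iff_le_toReal
      (ENNReal.mul_ne_top (by simp) hr), ENNReal.toReal_mul] at this
    simpa using this
  have h1 := key h
  have h2 := key h'
  rw [abs_le] at *
  constructor <;> linarith

/-- The contraction is demanded only when `meanTanh μ < 1`. Otherwise both means are 1, both laws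
are `δ_⊤`, and the evolution does not move. -/
theorem isClose_evolve {lam rho : ℝ[X]} (hlam : IsDegreeDistribution lam)
    (hrho : IsDegreeDistribution rho) {Δ : ℕ} (hΔ : 1 ≤ Δ) (h0 : ∀ j < Δ, rho.coeff j = 0)
    (μ : ZMod 2 → Measure EReal) [∀ x, IsProbabilityMeasure (μ x)] (hbot : ∀ x, μ x {⊥} = 0)
    {θ : ℝ≥0∞} (hθ : meanTanh μ < 1 → meanTanh μ + meanExponent lam * θ ^ Δ ≤ θ) (l : ℕ) :
    IsClose (avgMeas (evolve lam rho μ l)) (avgMeas μ) (meanExponent lam * θ ^ Δ) := by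
  intro f hf B hB ε K hfK
  rcases lt_or_ge (meanTanh μ) 1 with h | h
  · exact enorm_integral_evolve_sub_le hlam hrho hΔ h0 μ (le_self_add.trans (hθ h)) (hθ h) hf hB
      hfK l
  · have hle (x : ZMod 2) : ∫⁻ m, absTanh m ∂μ x ≤ 1 :=
      (lintegral_mono absTanh_le_one).trans (by simp)
    have h2 : 2 ≤ ∫⁻ m, absTanh m ∂μ 0 + ∫⁻ m, absTanh m ∂μ 1 := by
      rw [meanTanh_eq] at h
      have := mul_le_mul_right h 2
      rwa [← mul_assoc, ENNReal.mul_inv_cancel (by simp) (by simp), one_mul, mul_one] at this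
    have htop (x : ZMod 2) : μ x = Measure.dirac ⊤ := by
      refine eq_dirac_top_of_lintegral_absTanh ?_ (hbot x)
      rw [← one_add_one_eq_two] at h2
      fin_cases x
      · exact (ENNReal.add_le_add_iff_right ENNReal.one_ne_top).1
          (h2.trans (add_le_add_right (hle 1) _))
      · exact (ENNReal.add_le_add_iff_left ENNReal.one_ne_top).1
          (h2.trans (add_le_add_left (hle 0) _))
    have hev : evolve lam rho μ l = μ := by
      funext x
      rw [funext htop, evolve_dirac_top hlam hrho (h0 0 hΔ)]
    simp [hev]

/-! ### Choice of the rate, and the polynomials `z^Δ ρ`. -/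

theorem exists_contraction {t L : ℝ≥0∞} (hL : L ≠ ⊤) :
    ∃ θ : ℝ≥0∞, 0 < θ ∧ θ < 1 ∧ ∀ᶠ Δ : ℕ in atTop, t < 1 → t + L * θ ^ Δ ≤ θ := by
  by_cases ht : t < 1
  · obtain ⟨θ, h1, h2⟩ := exists_between ht
    have hlim : Tendsto (fun Δ : ℕ => t + L * θ ^ Δ) atTop (𝓝 t) := by
      simpa using (ENNReal.Tendsto.const_mul
        (ENNReal.tendsto_pow_atTop_nhds_zero_of_lt_one h2) (Or.inr hL)).const_add t
    refine ⟨θ, bot_le.trans_lt h1, h2, ?_⟩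
    filter_upwards [hlim.eventually_lt_const h1] with Δ h _ using h.le
  · exact ⟨2⁻¹, by simp, by simp, Eventually.of_forall fun _ h => absurd h ht⟩

theorem IsDegreeDistribution.X_pow_mul {rho : ℝ[X]} (hrho : IsDegreeDistribution rho) (Δ : ℕ) :
    IsDegreeDistribution (X ^ Δ * rho) := by
  refine ⟨fun j => ?_, by simp [hrho.2]⟩
  rw [coeff_X_pow_mul']
  split_ifs
  exacts [hrho.1 _, le_rfl]

theorem coeff_X_pow_mul_of_lt (rho : ℝ[X]) {Δ j : ℕ} (h : j < Δ) : (X ^ Δ * rho).coeff j = 0 := by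
  rw [coeff_X_pow_mul', if_neg (not_le.2 h)]

end LDPC

end

/-! ### Assembly of the theorem. -/

theorem theorem1 {Y : Type*} [MeasurableSpace Y] (W : ZMod 2 → ProbabilityMeasure Y)
    (lam rho : Polynomial ℝ)
    (hlam : LDPC.IsDegreeDistribution lam) (hrho : LDPC.IsDegreeDistribution rho) (l₀ : ℕ) :
    ∃ p q : ℕ → ℕ → ProbabilityMeasure EReal,
      -- the evolved densities for `(λ, x^Δ ρ)` are probability distributions `p Δ l`, `q Δ l`
      (∀ Δ : ℕ, 1 ≤ Δ → ∀ l : ℕ,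
        (p Δ l : Measure EReal).toSignedMeasure =
            LDPC.avg (LDPC.linearDensity W lam (Polynomial.X ^ Δ * rho) l) ∧
          (q Δ l : Measure EReal).toSignedMeasure =
            LDPC.cosetDensity W lam (Polynomial.X ^ Δ * rho) l) ∧
      -- they have the same limit in distribution
      (∀ l ≤ l₀, ∃ ν : ProbabilityMeasure EReal,
        Tendsto (fun Δ => p Δ l) atTop (𝓝 ν) ∧ Tendsto (fun Δ => q Δ l) atTop (𝓝 ν)) ∧
      -- their bounded Lipschitz distance is exponentially small
      ∃ C c : ℝ, 0 < c ∧ c < 1 ∧ ∀ Δ : ℕ, 1 ≤ Δ → ∀ l ≤ l₀, ∀ f : EReal → ℝ, LDPC.IsBLTest f →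
        |(∫ m, f m ∂(p Δ l : Measure EReal)) - ∫ m, f m ∂(q Δ l : Measure EReal)| ≤ C * c ^ Δ := by
  -- Replacing `Δ` by `max Δ 1` keeps `p` and `q` probability measures at `Δ = 0`, where `ρ` may
  -- have a constant term.
  have hD (Δ : ℕ) := hrho.X_pow_mul (max Δ 1)
  have h0 (Δ j : ℕ) (hj : j < max Δ 1) := LDPC.coeff_X_pow_mul_of_lt rho hj
  have hmax (Δ : ℕ) : 1 ≤ max Δ 1 := le_max_right _ _
  let μ := LDPC.initialMeas W
  let κ := LDPC.avgMeas μ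
  have hp (Δ l : ℕ) (x : ZMod 2) :=
    LDPC.isProbabilityMeasure_evolve hlam (hD Δ) (h0 Δ 0 (hmax Δ)) μ l x
  have hq (Δ l : ℕ) (x : ZMod 2) :=
    LDPC.isProbabilityMeasure_evolve hlam (hD Δ) (h0 Δ 0 (hmax Δ)) (fun _ => κ) l x
  have hbot (x : ZMod 2) : μ x {⊥} = 0 := LDPC.initialMeas_bot W x
  have hbot' : κ {⊥} = 0 := by simp [κ, LDPC.avgMeas, hbot]
  have hκ : LDPC.avgMeas (fun _ => κ) = κ := LDPC.avgMeas_const κ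
  -- Equal initial strength lets the same `θ` and `N` serve both evolutions.
  have htanh : LDPC.meanTanh (fun _ => κ) = LDPC.meanTanh μ := by
    rw [LDPC.meanTanh, hκ, LDPC.meanTanh]
  have havg : LDPC.avg (LDPC.initialDensity W) = κ.toSignedMeasure :=
    (LDPC.toSignedMeasure_avgMeas μ).symm
  have hL := LDPC.meanExponent_ne_top lam
  obtain ⟨θ, hθ0, hθ1, hθ⟩ := LDPC.exists_contraction (t := LDPC.meanTanh μ) hL
  obtain ⟨N, hN⟩ := eventually_atTop.1 hθ
  let p (Δ l : ℕ) : ProbabilityMeasure EReal :=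
    ⟨LDPC.avgMeas (LDPC.evolve lam (Polynomial.X ^ max Δ 1 * rho) μ l), inferInstance⟩
  let q (Δ l : ℕ) : ProbabilityMeasure EReal :=
    ⟨LDPC.avgMeas (LDPC.evolve lam (Polynomial.X ^ max Δ 1 * rho) (fun _ => κ) l), inferInstance⟩
  have hclose (Δ l : ℕ) (hΔN : N ≤ Δ) (hΔ : 1 ≤ Δ) :
      LDPC.IsClose (p Δ l : Measure EReal) κ (LDPC.meanExponent lam * θ ^ Δ) ∧
        LDPC.IsClose (q Δ l : Measure EReal) κ (LDPC.meanExponent lam * θ ^ Δ) := by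
    have hΔ' : max Δ 1 = Δ := max_eq_left hΔ
    have hcoeff (j : ℕ) (hj : j < Δ) := LDPC.coeff_X_pow_mul_of_lt rho hj
    have h1 := LDPC.isClose_evolve hlam (hrho.X_pow_mul Δ) hΔ hcoeff μ hbot (hN Δ hΔN) l
    have h2 := LDPC.isClose_evolve hlam (hrho.X_pow_mul Δ) hΔ hcoeff (fun _ => κ)
      (fun _ => hbot') (by rw [htanh]; exact hN Δ hΔN) l
    rw [hκ] at h2
    constructor
    · change LDPC.IsClose (LDPC.avgMeas (LDPC.evolve lam (Polynomial.X ^ max Δ 1 * rho) μ l)) κ _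
      rw [hΔ']
      exact h1
    · change LDPC.IsClose
        (LDPC.avgMeas (LDPC.evolve lam (Polynomial.X ^ max Δ 1 * rho) (fun _ => κ) l)) κ _
      rw [hΔ']
      exact h2
  refine ⟨p, q, fun Δ hΔ l => ⟨?_, ?_⟩, fun l _ => ⟨⟨κ, inferInstance⟩, ?_, ?_⟩, ?_⟩
  · have key (D : ℕ) (hD' : max Δ 1 = D) : (p Δ l : Measure EReal).toSignedMeasure =
        LDPC.avg (LDPC.linearDensity W lam (Polynomial.X ^ D * rho) l) := by
      subst hD'
      refine (LDPC.toSignedMeasure_avgMeas _).trans ?_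
      rw [LDPC.avg, LDPC.linearDensity_eq W hlam (hD _) (h0 _ 0 (hmax _)) μ fun _ => rfl,
        LDPC.linearDensity_eq W hlam (hD _) (h0 _ 0 (hmax _)) μ fun _ => rfl]
    exact key Δ (max_eq_left hΔ)
  · have key (D : ℕ) (hD' : max Δ 1 = D) : (q Δ l : Measure EReal).toSignedMeasure =
        LDPC.cosetDensity W lam (Polynomial.X ^ D * rho) l := by
      subst hD'
      refine (LDPC.toSignedMeasure_avgMeas _).trans ?_
      have hc := LDPC.cosetDensity_eq W hlam (hD Δ) (h0 Δ 0 (hmax Δ)) κ havg l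
      rw [← hc 0, ← hc 1]
      module
    exact key Δ (max_eq_left hΔ)
  · refine LDPC.tendsto_of_isClose (r := fun Δ => LDPC.meanExponent lam * θ ^ Δ) ?_ ?_
    · simpa using ENNReal.Tendsto.const_mul
        (ENNReal.tendsto_pow_atTop_nhds_zero_of_lt_one hθ1) (Or.inr hL)
    · filter_upwards [eventually_ge_atTop N, eventually_ge_atTop 1] with Δ h1 h2
      exact (hclose Δ l h1 h2).1
  · refine LDPC.tendsto_of_isClose (r := fun Δ => LDPC.meanExponent lam * θ ^ Δ) ?_ ?_
    · simpa using ENNReal.Tendsto.const_mul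
        (ENNReal.tendsto_pow_atTop_nhds_zero_of_lt_one hθ1) (Or.inr hL)
    · filter_upwards [eventually_ge_atTop N, eventually_ge_atTop 1] with Δ h1 h2
      exact (hclose Δ l h1 h2).2
  · have hθtop : θ ≠ ⊤ := hθ1.ne_top
    have hc0 : 0 < θ.toReal := ENNReal.toReal_pos hθ0.ne' hθtop
    have hc1 : θ.toReal < 1 := by
      simpa using (ENNReal.toReal_lt_toReal hθtop ENNReal.one_ne_top).2 hθ1
    -- The first summand of `C` handles `Δ ≥ N`. The second makes the bound at least 2, hence
    -- trivial, for the finitely many `Δ ≤ N`.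
    refine ⟨8 * (LDPC.meanExponent lam).toReal + 2 / θ.toReal ^ N, θ.toReal, hc0, hc1,
      fun Δ hΔ l _ f hf => ?_⟩
    rw [add_mul]
    rcases le_total N Δ with h | h
    · obtain ⟨h1, h2⟩ := hclose Δ l h hΔ
      refine (LDPC.abs_integral_sub_le_of_isClose
        (ENNReal.mul_ne_top hL (ENNReal.pow_ne_top hθtop)) h1 h2 hf).trans ?_
      rw [ENNReal.toReal_mul, ENNReal.toReal_pow, ← mul_assoc]
      exact le_add_of_nonneg_right (by positivity)
    · have hone (η : ProbabilityMeasure EReal) : |∫ m, f m ∂(η : Measure EReal)| ≤ 1 := by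
        simpa using norm_integral_le_of_norm_le_const (μ := (η : Measure EReal))
          (f := f) (C := 1)
          (ae_of_all _ hf.1)
      have h2 : 2 ≤ 2 / θ.toReal ^ N * θ.toReal ^ Δ := by
        rw [div_mul_eq_mul_div, le_div_iff₀ (by positivity)]
        exact mul_le_mul_of_nonneg_left (pow_le_pow_of_le_one hc0.le hc1.le h) (by norm_num)
      refine ((abs_sub _ _).trans (add_le_add (hone _) (hone _))).trans ?_
      have : 0 ≤ 8 * (LDPC.meanExponent lam).toReal * θ.toReal ^ Δ := by positivity
      linarith
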